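/- **Theorem 1.7 (Complete Characterization).** Let $G$ be a directed weighted (multi)graph with finite vertex set $V$, $|V|=n$, finite edge set $E$, $|E|=m$, positive real edge capacities $w$, a source $s$ and a sink $t\ne s$. *Definitions.* An $(s,t)$-cut is a set $C\subseteq V$ with $s\in C$, $t\notin C$; an edge contributes to $C$ if it leaves $C$; the capacity $c(C)$ is the sum of the capacities of the contributing edges. An $(s,t)$-mincut is an $(s,t)$-cut of the least capacity. An edge is vital if its removal decreases the capacity of the $(s,t)$-mincut. An $(s,t)$-cut $C$ is a mincut for an edge $e$ if $e$ contributes to $C$ and $c(C)\le c(C')$ for each $(s,t)$-cut $C'$ to which $e$ contributes. A vital edge $e$ is tight if $f(e)=w(e)$ for some maximum $(s,t)$-flow $f$, and loose otherwise. For $S\subseteq V$, a Steiner $(s,t)$-mincut for $S$ is an $(s,t)$-cut of the least capacity among those with at least one vertex of $S$ on each side. The hierarchy tree has the root set $V$, and the children of a node with set $S$, $|S|\ge 2$, have as their sets the classes of $S$ under the relation "not separated by any Steiner $(s,t)$-mincut for $S$"; its leaves are the single vertices. All DAGs below are directed acyclic graphs whose nodes form a partition of $V$. Such a DAG stores a cut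 $C$ if $C$ is a union of its nodes, and $C$ is $1$-transversal in it if, in addition, each simple directed path of the DAG has at most one edge with exactly one endpoint in $C$. Space is counted in words, up to a constant factor: a DAG takes $n$ (the map from vertices to nodes) plus its numbers of nodes and of edges. *Statement.* There is an absolute constant $c$ such that each such $G$ has a structure $\mathcal S_{vit}(G)$ that consists of at most $cn$ DAGs and of a table that assigns to each vital edge $e$ two of these DAGs, $\mathcal D^s(e)$ and $\mathcal D^t(e)$ (possibly the same one), occupies at most $c\,mn$ space in total, and has the following properties for each vital edge $e=(u,v)$. 1. Each mincut for $e$ is stored in $\mathcal D^s(e)$ or in $\mathcal D^t(e)$. 2. An $(s,t)$-cut $C$ in $G$ is a mincut for $e$ if and only if $C$ is a $1$-transversal cut in $\mathcal D^s(e)$ or in $\mathcal D^t(e)$, and $e$ is a contributing edge of $C$. 3. If $e$ is loose, then $\mathcal D^s(e)=\mathcal D^t(e)$ is a Picard–Queyranne DAG for the mincuts for $e$: its $1$-transversal $(s,t)$-cuts are exactly the mincuts for $e$. If $e$ is tight, let $S$ be the set at the lowest common ancestor of the leaves of $u$ and $v$ in the hierarchy tree. Then the $1$-transversal $(s,t)$-cuts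 in $\mathcal D^s(e)$ are exactly the Steiner $(s,t)$-mincuts $C$ for $S$ with $\mu\in C$, $v\notin C$, and those in $\mathcal D^t(e)$ are exactly the Steiner $(s,t)$-mincuts $C$ for $S$ with $u\in C$, $\mu\notin C$. Here $\mu=\mu(S)\in S$ is a pivot vertex that depends only on $G$ and $S$. -/

import Mathlib

/-- A directed weighted (multi)graph with vertex type `V` and edge type `E`, positive real
capacities, a designated source `s` and a designated sink `t`. -/
structure STNetwork (V E : Type*) where
  src : E → V
  tgt : E → V
  w : E → ℝ
  w_pos : ∀ e, 0 < w e
  s : V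
  t : V
  s_ne_t : s ≠ t

namespace STNetwork

variable {V E : Type*}

/-- `C` is an `(s,t)`-cut. -/
def IsCut (G : STNetwork V E) (C : Set V) : Prop := G.s ∈ C ∧ G.t ∉ C

/-- The edge `e` is a contributing (outgoing) edge of `C`. -/
def Contributes (G : STNetwork V E) (C : Set V) (e : E) : Prop := G.src e ∈ C ∧ G.tgt e ∉ C

open Classical in
/-- The capacity `c(C)`: the sum of the capacities of the contributing edges of `C`. -/
noncomputable def capacity [Fintype E] (G : STNetwork V E) (C : Set V) : ℝ :=
  ∑ e : E, if G.Contributes C e then G.w e else 0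

/-- The capacity `f*` of an `(s,t)`-mincut. (For finite `V` it is an infimum over a finite set,
which is nonempty since `s ≠ t`; so it is a minimum, see `exists_capacity_eq_minCutValue`.) -/
noncomputable def minCutValue [Fintype E] (G : STNetwork V E) : ℝ :=
  ⨅ C : {C : Set V // G.IsCut C}, G.capacity C.1

theorem exists_capacity_eq_minCutValue [Finite V] [Fintype E] (G : STNetwork V E) :
    ∃ C, G.IsCut C ∧ G.capacity C = G.minCutValue := by
  have : Nonempty {C : Set V // G.IsCut C} := ⟨⟨{G.s}, rfl, fun h => G.s_ne_t h.symm⟩⟩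
  obtain ⟨C, hC⟩ := exists_eq_ciInf_of_finite (f := fun C : {C : Set V // G.IsCut C} =>
    G.capacity C.1)
  exact ⟨C.1, C.2, hC⟩

/-- The graph after the removal of the edge `e`. -/
def deleteEdge (G : STNetwork V E) (e : E) : STNetwork V {e' : E // e' ≠ e} where
  src e' := G.src e'
  tgt e' := G.tgt e'
  w e' := G.w e'
  w_pos e' := G.w_pos e'
  s := G.s
  t := G.t
  s_ne_t := G.s_ne_t

open Classical in
/-- The edge `e` is vital: its removal decreases the capacity of the `(s,t)`-mincut. -/
def IsVital [Fintype E] (G : STNetwork V E) (e : E) : Prop :=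
  (G.deleteEdge e).minCutValue < G.minCutValue

/-- `C` is a mincut for the edge `e`. -/
def IsMincutFor [Fintype E] (G : STNetwork V E) (e : E) (C : Set V) : Prop :=
  G.IsCut C ∧ G.Contributes C e ∧
    ∀ C', G.IsCut C' → G.Contributes C' e → G.capacity C ≤ G.capacity C'

open Classical in
/-- The net flow out of the vertex `v`. -/
noncomputable def netOut [Fintype E] (G : STNetwork V E) (f : E → ℝ) (v : V) : ℝ :=
  (∑ e : E, if G.src e = v then f e else 0) - ∑ e : E, if G.tgt e = v then f e else 0

/-- `f` is an `(s,t)`-flow: capacity constraints, and conservation outside `s` and `t`.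
Its value is `G.netOut f G.s`. -/
def IsFlow [Fintype E] (G : STNetwork V E) (f : E → ℝ) : Prop :=
  (∀ e, 0 ≤ f e ∧ f e ≤ G.w e) ∧ ∀ v, v ≠ G.s → v ≠ G.t → G.netOut f v = 0

/-- `f` is a maximum `(s,t)`-flow. -/
def IsMaxFlow [Fintype E] (G : STNetwork V E) (f : E → ℝ) : Prop :=
  G.IsFlow f ∧ ∀ g, G.IsFlow g → G.netOut g G.s ≤ G.netOut f G.s

/-- A tight edge: a vital edge that some maximum `(s,t)`-flow saturates. -/
def IsTight [Fintype E] (G : STNetwork V E) (e : E) : Prop :=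
  G.IsVital e ∧ ∃ f, G.IsMaxFlow f ∧ f e = G.w e

/-- A loose edge: a vital edge that no maximum `(s,t)`-flow saturates. -/
def IsLoose [Fintype E] (G : STNetwork V E) (e : E) : Prop :=
  G.IsVital e ∧ ¬ ∃ f, G.IsMaxFlow f ∧ f e = G.w e

/-- `C` is a Steiner `(s,t)`-cut for the Steiner set `S`: an `(s,t)`-cut with vertices of `S` on
both of its sides. -/
def IsSteinerCut (G : STNetwork V E) (S C : Set V) : Prop :=
  G.IsCut C ∧ (S ∩ C).Nonempty ∧ (S ∩ Cᶜ).Nonempty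

/-- `C` is a Steiner `(s,t)`-mincut for `S`: a Steiner `(s,t)`-cut of the least capacity. -/
def IsSteinerMincut [Fintype E] (G : STNetwork V E) (S C : Set V) : Prop :=
  G.IsSteinerCut S C ∧ ∀ C', G.IsSteinerCut S C' → G.capacity C ≤ G.capacity C'

/-- No Steiner `(s,t)`-mincut for `S` separates `x` and `y`. On `S` this is an equivalence
relation. -/
def NotSeparated [Fintype E] (G : STNetwork V E) (S : Set V) (x y : V) : Prop :=
  ∀ C, G.IsSteinerMincut S C → (x ∈ C ↔ y ∈ C)

/-- The Steiner sets at the nodes of the hierarchy tree: the root carries `V`, and the children of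
a node whose set `S` has at least two elements carry the equivalence classes of `S` under
`NotSeparated S`. -/
inductive IsTreeNode [Fintype E] (G : STNetwork V E) : Set V → Prop
  | root : IsTreeNode G Set.univ
  | child (S : Set V) (x : V) : IsTreeNode G S → S.Nontrivial → x ∈ S →
      IsTreeNode G {y | y ∈ S ∧ G.NotSeparated S x y}

/-- `S` is the Steiner set at the lowest common ancestor, in the hierarchy tree, of the leaves of
`u` and `v`: the node that contains both of them and whose children separate them. -/
def IsLCA [Fintype E] (G : STNetwork V E) (S : Set V) (u v : V) : Prop :=
  G.IsTreeNode S ∧ u ∈ S ∧ v ∈ S ∧ ¬ G.NotSeparated S u v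

end STNetwork

/-- A directed acyclic graph whose nodes are obtained by contracting vertices of `V`: `proj` is
the (surjective) map that takes each vertex to the node that contains it. -/
structure QuotientDAG (V : Type*) where
  numNodes : ℕ
  proj : V → Fin numNodes
  proj_surjective : Function.Surjective proj
  edges : Finset (Fin numNodes × Fin numNodes)
  acyclic : ∀ x, ¬ Relation.TransGen (fun a b => (a, b) ∈ edges) x x

namespace QuotientDAG

variable {V : Type*}

/-- `p` is a simple directed path with `k` edges. -/
def IsSimplePath (D : QuotientDAG V) (k : ℕ) (p : Fin (k + 1) → Fin D.numNodes) : Prop :=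
  Function.Injective p ∧ ∀ i : Fin k, (p i.castSucc, p i.succ) ∈ D.edges

/-- The set of nodes `X` is the cut `C ⊆ V`: every node lies entirely inside or outside `C`, and
`X` consists of the nodes inside. -/
def Represents (D : QuotientDAG V) (X : Set (Fin D.numNodes)) (C : Set V) : Prop :=
  D.proj ⁻¹' X = C

/-- `C` is stored in `D`: it is a cut of `D`. -/
def Stores (D : QuotientDAG V) (C : Set V) : Prop := ∃ X, D.Represents X C

/-- `C` is an `ℓ`-transversal cut in `D`: it is a cut of `D`, and each simple path has at most `ℓ`
edges in the edge-set of the cut, that is, with exactly one endpoint inside it. -/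
def IsTransversal (D : QuotientDAG V) (ℓ : ℕ) (C : Set V) : Prop :=
  ∃ X, D.Represents X C ∧ ∀ (k : ℕ) (p : Fin (k + 1) → Fin D.numNodes), D.IsSimplePath k p →
    {i : Fin k | ¬ (p i.castSucc ∈ X ↔ p i.succ ∈ X)}.ncard ≤ ℓ

/-- The space of `D`, up to a constant factor, in words: the table of the map from the vertices to
the nodes, the nodes, and the edges. -/
def space [Fintype V] (D : QuotientDAG V) : ℕ :=
  Fintype.card V + D.numNodes + D.edges.card

end QuotientDAG

/-- A structure that consists of finitely many DAGs and a table that can assign a pair of them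
(possibly the same DAG twice) to an edge. -/
structure DAGStructure (V E : Type*) where
  numDAGs : ℕ
  dag : Fin numDAGs → QuotientDAG V
  table : E → Option (Fin numDAGs × Fin numDAGs)

/-- The total space, in words: the space of all the DAGs and the two pointers for each edge. -/
def DAGStructure.space {V E : Type*} [Fintype V] [Fintype E] (F : DAGStructure V E) : ℕ :=
  (∑ i, (F.dag i).space) + 2 * Fintype.card E

/-!
Residual graphs reduce every DAG that is needed to one construction. The minimum cuts that separate
`s, a` from `t, b` are the vertex sets that no edge leaves in the residual graph of a maximum flow
between these terminals (`STNetwork.exists_implications`), that is, the sets that respect `O(m)`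
implications of the form "`y ∈ C` implies `x ∈ C`". The strongly connected components of these
implications, together with edges from `s` to all vertices and from all vertices to `t`, form a
DAG whose 1-transversal `(s,t)`-cuts are exactly the sets that respect the implications
(`QuotientDAG.exists_isTransversal_iff`): an edge in the wrong direction would lie on a path
`s, a, b, t` that crosses the cut three times.

The mincuts for an edge `(u, v)` are of this kind, with `a = u` and `b = v`. If `(u, v)` is tight
and `S` is the lowest common ancestor of `u` and `v`, they are the Steiner mincuts for `S` to which
the edge contributes (`STNetwork.IsTight.isMincutFor_iff`). Indeed, some Steiner mincut `D`
separates `u` from `v`. If the edge entered `D`, a maximum flow that saturates the edge would give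
`c(D) ≥ f* + w(e)`; but by vitality there is a cut of smaller capacity to which the edge
contributes, and this is a Steiner cut for `S` as well. The Steiner mincuts for `S` with the pivot
of `S` on one side and a given vertex of `S` on the other are again of the above kind, unless there
are none, and depend only on the class of that vertex.

It remains to count the DAGs. There are at most `n` loose edges (`STNetwork.card_isLoose_le`), since
at an extreme point of the polytope of maximum flows the edges that are neither empty nor saturated
carry no nonzero circulation, and these include the loose edges. For the tight edges, the pivot of
a set is its least element in a fixed numbering of the vertices. As the tree is laminar
(`STNetwork.IsTreeNode.subset_cell_or_subset`), a child that does not contain the pivot of its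
parent is determined by its own pivot (`STNetwork.IsTreeNode.eq_of_pivot`), so that `n` DAGs of
each of the two types suffice, besides one without 1-transversal `(s,t)`-cuts.
-/

/-! ### Flows between two sets of terminals -/

namespace STNetwork

variable {V E : Type*} [Fintype V] [Fintype E]

/-- `f` is a flow with sources in `A` and sinks in `B`: capacity constraints, and conservation
outside the terminals. -/
def IsFlowBetween (G : STNetwork V E) (A B : Set V) (f : E → ℝ) : Prop :=
  (∀ e, 0 ≤ f e ∧ f e ≤ G.w e) ∧ ∀ v, v ∉ A → v ∉ B → G.netOut f v = 0

/-- The net amount of `f` that leaves the vertices of `A`. -/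
noncomputable def netOutSet (G : STNetwork V E) (A : Set V) (f : E → ℝ) : ℝ :=
  ∑ v, A.indicator 1 v * G.netOut f v

/-- The residual graph of `f` has an edge from `x` to `y`. -/
def Residual (G : STNetwork V E) (f : E → ℝ) (x y : V) : Prop :=
  ∃ e, (G.src e = x ∧ G.tgt e = y ∧ f e < G.w e) ∨ (G.tgt e = x ∧ G.src e = y ∧ 0 < f e)

open Classical in
/-- The contribution of the edge `e` to the residual capacity of the cut `C`. -/
noncomputable def slack (G : STNetwork V E) (C : Set V) (f : E → ℝ) (e : E) : ℝ :=
  if G.src e ∈ C then (if G.tgt e ∈ C then 0 else G.w e - f e) else if G.tgt e ∈ C then f e else 0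

omit [Fintype V] [Fintype E] in
theorem slack_nonneg {G : STNetwork V E} {f : E → ℝ} (hf : ∀ e, 0 ≤ f e ∧ f e ≤ G.w e)
    (C : Set V) (e : E) : 0 ≤ G.slack C f e := by
  have := hf e
  unfold slack
  split_ifs <;> linarith

/-- Summation by parts: a potential `p` paired with the divergence of `f`. -/
theorem sum_mul_netOut (G : STNetwork V E) (p : V → ℝ) (f : E → ℝ) :
    ∑ v, p v * G.netOut f v = ∑ e, f e * (p (G.src e) - p (G.tgt e)) := by
  classical
  simp only [netOut, mul_sub, Finset.mul_sum, Finset.sum_sub_distrib]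
  congr 1 <;> rw [Finset.sum_comm] <;> refine Finset.sum_congr rfl fun e _ => ?_ <;>
    simp [mul_comm]

omit [Fintype V] in
theorem netOut_add_mul (G : STNetwork V E) (f g : E → ℝ) (c : ℝ) (v : V) :
    G.netOut (fun e => f e + c * g e) v = G.netOut f v + c * G.netOut g v := by
  classical
  simp only [netOut, mul_sub, Finset.mul_sum, mul_ite, mul_zero]
  rw [← add_sub_add_comm, ← Finset.sum_add_distrib, ← Finset.sum_add_distrib]
  congr 1 <;> refine Finset.sum_congr rfl fun e _ => ?_ <;> split_ifs <;> simp

theorem netOutSet_add_mul (G : STNetwork V E) (A : Set V) (f g : E → ℝ) (c : ℝ) :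
    G.netOutSet A (fun e => f e + c * g e) = G.netOutSet A f + c * G.netOutSet A g := by
  simp only [netOutSet, netOut_add_mul, Finset.mul_sum, ← Finset.sum_add_distrib]
  exact Finset.sum_congr rfl fun v _ => by ring

theorem netOutSet_singleton (G : STNetwork V E) (a : V) (f : E → ℝ) :
    G.netOutSet {a} f = G.netOut f a := by
  classical
  simp [netOutSet, Set.indicator_apply]

/-- The capacity of a cut that separates the terminals is the value of the flow plus the residual
capacity of the cut. -/
theorem capacity_eq_add_slack {G : STNetwork V E} {A B C : Set V} {f : E → ℝ}
    (hf : G.IsFlowBetween A B f) (hA : A ⊆ C) (hB : ∀ b ∈ B, b ∉ C) :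
    G.capacity C = G.netOutSet A f + ∑ e, G.slack C f e := by
  classical
  have h1 : G.netOutSet A f = ∑ v, C.indicator 1 v * G.netOut f v := by
    refine Finset.sum_congr rfl fun v _ => ?_
    by_cases hvC : v ∈ C
    · by_cases hvA : v ∈ A
      · simp [hvC, hvA]
      · simp [hf.2 v hvA fun h => hB v h hvC]
    · have hvA : v ∉ A := fun h => hvC (hA h)
      simp [hvC, hvA]
  rw [h1, sum_mul_netOut, capacity, ← Finset.sum_add_distrib]
  refine Finset.sum_congr rfl fun e _ => ?_
  by_cases h1 : G.src e ∈ C <;> by_cases h2 : G.tgt e ∈ C <;> simp [Contributes, slack, h1, h2]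

omit [Fintype V] in
/-- A cut has no residual capacity exactly if no residual edge leaves it. -/
theorem sum_slack_eq_zero_iff {G : STNetwork V E} {f : E → ℝ}
    (hf : ∀ e, 0 ≤ f e ∧ f e ≤ G.w e) (C : Set V) :
    ∑ e, G.slack C f e = 0 ↔ ∀ x y, G.Residual f x y → x ∈ C → y ∈ C := by
  rw [Finset.sum_eq_zero_iff_of_nonneg fun e _ => slack_nonneg hf C e]
  constructor
  · rintro h x y ⟨e, ⟨rfl, rfl, he⟩ | ⟨rfl, rfl, he⟩⟩ hx <;> by_contra hy <;>
      have := h e (Finset.mem_univ e) <;> simp [slack, hx, hy] at this <;> linarith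
  · intro h e _
    have h1 := h (G.src e) (G.tgt e)
    have h2 := h (G.tgt e) (G.src e)
    have := hf e
    unfold slack
    split_ifs with hs ht ht
    · rfl
    · by_contra hne
      exact ht (h1 ⟨e, .inl ⟨rfl, rfl, lt_of_le_of_ne this.2 fun h => hne (by linarith)⟩⟩ hs)
    · by_contra hne
      exact hs (h2 ⟨e, .inr ⟨rfl, rfl, lt_of_le_of_ne this.1 (Ne.symm hne)⟩⟩ ht)
    · rfl

/-! ### Augmentation, and the max-flow min-cut theorem -/

omit [Fintype V] in
/-- If `g` increases only unsaturated edges and decreases only edges with positive flow, then a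
small multiple of `g` may be added to `f`. -/
theorem exists_step {f w g : E → ℝ} (hf : ∀ e, 0 ≤ f e ∧ f e ≤ w e)
    (hg : ∀ e, (0 < g e → f e < w e) ∧ (g e < 0 → 0 < f e)) :
    ∃ ε > 0, ∀ e, 0 ≤ f e + ε * g e ∧ f e + ε * g e ≤ w e := by
  have key : ∀ᶠ ε in nhdsWithin (0 : ℝ) (Set.Ioi 0),
      ∀ e, 0 ≤ f e + ε * g e ∧ f e + ε * g e ≤ w e := by
    rw [Filter.eventually_all]
    intro e
    have hc : Filter.Tendsto (fun ε : ℝ => f e + ε * g e) (nhdsWithin 0 (Set.Ioi 0))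
        (nhds (f e)) := by
      have : Continuous fun ε : ℝ => f e + ε * g e := by fun_prop
      simpa using (this.tendsto 0).mono_left nhdsWithin_le_nhds
    have hpos : ∀ᶠ ε in nhdsWithin (0 : ℝ) (Set.Ioi 0), 0 < ε := self_mem_nhdsWithin
    refine Filter.Eventually.and ?_ ?_
    · rcases lt_or_ge (g e) 0 with h | h
      · exact (hc.eventually_const_lt ((hg e).2 h)).mono fun _ => le_of_lt
      · filter_upwards [hpos] with ε hε
        have := mul_nonneg hε.le h
        linarith [(hf e).1]
    · rcases lt_or_ge 0 (g e) with h | h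
      · exact (hc.eventually_lt_const ((hg e).1 h)).mono fun _ => le_of_lt
      · filter_upwards [hpos] with ε hε
        have := mul_nonpos_of_nonneg_of_nonpos hε.le h
        linarith [(hf e).2]
  have hpos : ∀ᶠ ε in nhdsWithin (0 : ℝ) (Set.Ioi 0), 0 < ε := self_mem_nhdsWithin
  obtain ⟨ε, h1, h2⟩ := (hpos.and key).exists
  exact ⟨ε, h1, h2⟩

omit [Fintype V] in
/-- A residual path from `a` to `x` carries a unit of flow in the residual graph. Its divergence is
recorded by pairing with potentials. The sign conditions are those of a convex cone, so that the
edges of the path may be added up even if the path repeats them. -/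
theorem exists_augmentation {G : STNetwork V E} {f : E → ℝ} {a x : V}
    (h : Relation.ReflTransGen (G.Residual f) a x) :
    ∃ g : E → ℝ, (∀ e, (0 < g e → f e < G.w e) ∧ (g e < 0 → 0 < f e)) ∧
      ∀ p : V → ℝ, ∑ e, g e * (p (G.src e) - p (G.tgt e)) = p a - p x := by
  classical
  induction h with
  | refl => exact ⟨0, by simp, by simp⟩
  | @tail y z _ hyz ih =>
    obtain ⟨g, hg, hp⟩ := ih
    obtain ⟨e₀, ⟨rfl, rfl, he⟩ | ⟨rfl, rfl, he⟩⟩ := hyz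
    · refine ⟨fun e => g e + if e = e₀ then 1 else 0, fun e => ?_, fun p => ?_⟩
      · by_cases h : e = e₀
        · subst h
          refine ⟨fun _ => he, fun h => (hg e).2 ?_⟩
          simp at h
          linarith
        · simpa [h] using hg e
      · simp only [add_mul, Finset.sum_add_distrib, hp]
        simp
    · refine ⟨fun e => g e + if e = e₀ then -1 else 0, fun e => ?_, fun p => ?_⟩
      · by_cases h : e = e₀
        · subst h
          refine ⟨fun h => (hg e).1 ?_, fun _ => he⟩
          simp at h
          linarith
        · simpa [h] using hg e
      · simp only [add_mul, Finset.sum_add_distrib, hp]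
        simp

omit [Fintype V] in
theorem continuous_netOut (G : STNetwork V E) (v : V) : Continuous fun f => G.netOut f v := by
  classical
  unfold netOut
  refine Continuous.sub (continuous_finsetSum _ fun e _ => ?_)
    (continuous_finsetSum _ fun e _ => ?_) <;> split_ifs <;> fun_prop

omit [Fintype V] in
theorem isCompact_isFlowBetween (G : STNetwork V E) (A B : Set V) :
    IsCompact {f | G.IsFlowBetween A B f} := by
  have h1 : IsCompact (Set.univ.pi fun e => Set.Icc 0 (G.w e)) :=
    isCompact_univ_pi fun e => isCompact_Icc
  have h2 : IsClosed {f : E → ℝ | ∀ v, v ∉ A → v ∉ B → G.netOut f v = 0} := by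
    simp only [Set.ofPred_forall]
    exact isClosed_iInter fun v => isClosed_iInter fun _ => isClosed_iInter fun _ =>
      isClosed_eq (G.continuous_netOut v) continuous_const
  convert h1.inter_right h2 using 1
  ext f
  simp [IsFlowBetween, Pi.le_def, forall_and]

/-- Max-flow min-cut: for disjoint terminal sets some flow has the value of some cut. -/
theorem exists_flow_cut (G : STNetwork V E) {A B : Set V} (hAB : Disjoint A B) :
    ∃ f C, G.IsFlowBetween A B f ∧ A ⊆ C ∧ (∀ b ∈ B, b ∉ C) ∧
      G.capacity C = G.netOutSet A f := by
  classical
  have hcont : Continuous fun f => G.netOutSet A f :=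
    continuous_finsetSum _ fun v _ => continuous_const.mul (G.continuous_netOut v)
  obtain ⟨f, hf, hmax⟩ := (G.isCompact_isFlowBetween A B).exists_isMaxOn
    ⟨0, fun e => ⟨le_rfl, (G.w_pos e).le⟩, by simp [netOut]⟩ hcont.continuousOn
  -- the cut consists of the vertices that are reachable in the residual graph
  let C : Set V := {x | ∃ a ∈ A, Relation.ReflTransGen (G.Residual f) a x}
  have hAC : A ⊆ C := fun a ha => ⟨a, ha, .refl⟩
  have hB : ∀ b ∈ B, b ∉ C := by
    rintro b hb ⟨a, ha, hab⟩
    obtain ⟨g, hg, hp⟩ := exists_augmentation hab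
    obtain ⟨ε, hε, hstep⟩ := exists_step hf.1 hg
    have hbA : b ∉ A := fun h => Set.disjoint_left.1 hAB h hb
    have hnet : ∀ v, v ∉ A → v ∉ B → G.netOut g v = 0 := by
      intro v hA hB
      have := G.sum_mul_netOut (Set.indicator {v} 1) g
      rw [hp] at this
      have hav : a ≠ v := fun h => hA (h ▸ ha)
      have hbv : b ≠ v := fun h => hB (h ▸ hb)
      simpa [Set.indicator_apply, hav, hbv] using this
    have hval : G.netOutSet A g = 1 := by
      rw [netOutSet, sum_mul_netOut, hp]
      simp [ha, hbA]
    have hflow : G.IsFlowBetween A B fun e => f e + ε * g e :=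
      ⟨hstep, fun v hA hB => by rw [netOut_add_mul, hf.2 v hA hB, hnet v hA hB]; simp⟩
    have := hmax hflow
    simp only [netOutSet_add_mul, hval, Set.mem_ofPred_eq] at this
    linarith
  refine ⟨f, C, hf, hAC, hB, ?_⟩
  rw [capacity_eq_add_slack hf hAC hB,
    (sum_slack_eq_zero_iff hf.1 _).2 ?_, add_zero]
  rintro x y hxy ⟨a, ha, hax⟩
  exact ⟨a, ha, hax.tail hxy⟩

/-! ### Maximum flows and vital edges -/

omit [Fintype V] in
theorem isFlow_iff_isFlowBetween (G : STNetwork V E) (f : E → ℝ) :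
    G.IsFlow f ↔ G.IsFlowBetween {G.s} {G.t} f := by
  simp [IsFlow, IsFlowBetween]

theorem IsFlow.capacity_eq {G : STNetwork V E} {f : E → ℝ} (hf : G.IsFlow f) {C : Set V}
    (hC : G.IsCut C) : G.capacity C = G.netOut f G.s + ∑ e, G.slack C f e := by
  rw [← netOutSet_singleton]
  exact capacity_eq_add_slack ((G.isFlow_iff_isFlowBetween f).1 hf) (by simpa using hC.1)
    (by simpa using hC.2)

theorem minCutValue_le (G : STNetwork V E) {C : Set V} (hC : G.IsCut C) :
    G.minCutValue ≤ G.capacity C :=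
  ciInf_le (f := fun C : {C : Set V // G.IsCut C} => G.capacity C.1)
    (Set.finite_range _).bddBelow ⟨C, hC⟩

theorem IsFlow.netOut_le {G : STNetwork V E} {f : E → ℝ} (hf : G.IsFlow f) :
    G.netOut f G.s ≤ G.minCutValue := by
  obtain ⟨C, hC, h⟩ := G.exists_capacity_eq_minCutValue
  have := Finset.sum_nonneg fun e (_ : e ∈ Finset.univ) => slack_nonneg hf.1 C e
  linarith [hf.capacity_eq hC]

theorem isMaxFlow_iff (G : STNetwork V E) (f : E → ℝ) :
    G.IsMaxFlow f ↔ G.IsFlow f ∧ G.netOut f G.s = G.minCutValue := by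
  constructor
  · rintro ⟨hf, hmax⟩
    obtain ⟨g, C, hg, hs, ht, hC⟩ := G.exists_flow_cut (A := {G.s}) (B := {G.t})
      (by simpa using G.s_ne_t)
    refine ⟨hf, le_antisymm hf.netOut_le ?_⟩
    have h1 := G.minCutValue_le (C := C) ⟨by simpa using hs, by simpa using ht⟩
    have h2 := hmax g ((G.isFlow_iff_isFlowBetween g).2 hg)
    rw [netOutSet_singleton] at hC
    linarith
  · rintro ⟨hf, h⟩
    exact ⟨hf, fun g hg => h ▸ hg.netOut_le⟩

theorem exists_isMaxFlow (G : STNetwork V E) : ∃ f, G.IsMaxFlow f := by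
  obtain ⟨g, C, hg, hs, ht, hC⟩ := G.exists_flow_cut (A := {G.s}) (B := {G.t})
    (by simpa using G.s_ne_t)
  have hg' := (G.isFlow_iff_isFlowBetween g).2 hg
  refine ⟨g, (G.isMaxFlow_iff g).2 ⟨hg', le_antisymm hg'.netOut_le ?_⟩⟩
  rw [netOutSet_singleton] at hC
  exact hC ▸ G.minCutValue_le (C := C) ⟨by simpa using hs, by simpa using ht⟩

open Classical in
omit [Fintype V] in
theorem capacity_eq_add_deleteEdge (G : STNetwork V E) (e : E) (C : Set V) :
    G.capacity C = (if G.Contributes C e then G.w e else 0) + (G.deleteEdge e).capacity C := by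
  simp only [capacity]
  rw [Fintype.sum_eq_add_sum_subtype_ne _ e]
  rfl

/-- A vital edge contributes to a cut whose other contributing edges are below the mincut
capacity. -/
theorem IsVital.exists_cut {G : STNetwork V E} {e : E} (he : G.IsVital e) :
    ∃ C, G.IsCut C ∧ G.Contributes C e ∧ G.capacity C < G.minCutValue + G.w e := by
  classical
  obtain ⟨C, hC, h⟩ := (G.deleteEdge e).exists_capacity_eq_minCutValue
  have h1 : (G.deleteEdge e).capacity C < G.minCutValue := h ▸ he
  have h2 := G.capacity_eq_add_deleteEdge e C
  have h3 := G.minCutValue_le (C := C) hC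
  by_cases hc : G.Contributes C e
  · rw [if_pos hc] at h2
    exact ⟨C, hC, hc, by linarith⟩
  · rw [if_neg hc] at h2
    linarith

theorem IsVital.src_ne_tgt {G : STNetwork V E} {e : E} (he : G.IsVital e) :
    G.src e ≠ G.tgt e := by
  obtain ⟨C, -, hc, -⟩ := he.exists_cut
  exact fun h => hc.2 (h ▸ hc.1)

/-- Every maximum flow uses each vital edge. -/
theorem IsMaxFlow.pos_of_isVital {G : STNetwork V E} {f : E → ℝ} (hf : G.IsMaxFlow f) {e : E}
    (he : G.IsVital e) : 0 < f e := by
  obtain ⟨hflow, hval⟩ := (G.isMaxFlow_iff f).1 hf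
  obtain ⟨C, hC, hc, hlt⟩ := he.exists_cut
  have h1 := Finset.single_le_sum (fun e _ => slack_nonneg hflow.1 C e) (Finset.mem_univ e)
  have h2 := hflow.capacity_eq hC
  have h3 : G.slack C f e = G.w e - f e := by simp [slack, hc.1, hc.2]
  linarith

/-- A cut that a tight edge enters has a larger capacity than the mincuts for that edge. -/
theorem IsTight.capacity_lt {G : STNetwork V E} {e : E} (he : G.IsTight e) {D : Set V}
    (hD : G.IsCut D) (hs : G.src e ∉ D) (ht : G.tgt e ∈ D) :
    ∃ C, G.IsCut C ∧ G.Contributes C e ∧ G.capacity C < G.capacity D := by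
  obtain ⟨hv, f, hf, hfe⟩ := he
  obtain ⟨hflow, hval⟩ := (G.isMaxFlow_iff f).1 hf
  obtain ⟨C, hC, hc, hlt⟩ := hv.exists_cut
  refine ⟨C, hC, hc, ?_⟩
  have h1 := Finset.single_le_sum (fun e _ => slack_nonneg hflow.1 D e) (Finset.mem_univ e)
  have h2 := hflow.capacity_eq hD
  have h3 : G.slack D f e = f e := by simp [slack, hs, ht]
  linarith

/-- There are at most as many loose edges as vertices. A loose edge is neither empty nor
saturated in any maximum flow, and at an extreme point of the polytope of maximum flows no nonzero
circulation is supported on such edges. -/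
theorem card_isLoose_le (G : STNetwork V E) : {e | G.IsLoose e}.ncard ≤ Fintype.card V := by
  classical
  have hcomp : IsCompact {f | G.IsMaxFlow f} := by
    have h1 := G.isCompact_isFlowBetween {G.s} {G.t}
    have h2 : IsClosed {f | G.netOut f G.s = G.minCutValue} :=
      isClosed_eq (G.continuous_netOut _) continuous_const
    convert h1.inter_right h2 using 1
    ext f
    simp [isMaxFlow_iff, isFlow_iff_isFlowBetween]
  obtain ⟨f, hf⟩ := hcomp.extremePoints_nonempty G.exists_isMaxFlow
  have hfmax : G.IsMaxFlow f := hf.1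
  obtain ⟨hflow, hval⟩ := (G.isMaxFlow_iff f).1 hfmax
  have hfrac : ∀ e, G.IsLoose e → 0 < f e ∧ f e < G.w e := fun e he =>
    ⟨hfmax.pos_of_isVital he.1, lt_of_le_of_ne (hflow.1 e).2 fun h => he.2 ⟨f, hfmax, h⟩⟩
  let ext0 (g : {e // G.IsLoose e} → ℝ) (e : E) : ℝ := if h : G.IsLoose e then g ⟨e, h⟩ else 0
  let φ : ({e // G.IsLoose e} → ℝ) →ₗ[ℝ] (V → ℝ) :=
    { toFun := fun g v => G.netOut (ext0 g) v
      map_add' := fun g h => by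
        ext v
        have := G.netOut_add_mul (ext0 g) (ext0 h) 1 v
        simp only [one_mul] at this
        rw [Pi.add_apply, ← this]
        congr 1
        ext e
        simp only [ext0]
        split_ifs <;> simp
      map_smul' := fun c g => by
        ext v
        have := G.netOut_add_mul 0 (ext0 g) c v
        simp only [Pi.zero_apply, zero_add] at this
        have h0 : G.netOut 0 v = 0 := by simp [netOut]
        rw [h0, zero_add] at this
        simp only [Pi.smul_apply, smul_eq_mul, RingHom.id_apply]
        rw [← this]
        congr 1
        ext e
        simp only [ext0]
        split_ifs <;> simp }
  have hinj : Function.Injective φ := by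
    rw [← LinearMap.ker_eq_bot, LinearMap.ker_eq_bot']
    intro g hg
    have hg0 : ∀ v, G.netOut (ext0 g) v = 0 := fun v => congrFun hg v
    have hbound : ∀ c : ℝ, ∃ ε > 0, ∀ e, 0 ≤ f e + ε * (c * ext0 g e) ∧
        f e + ε * (c * ext0 g e) ≤ G.w e := by
      refine fun c => exists_step hflow.1 fun e => ?_
      by_cases he : G.IsLoose e
      · exact ⟨fun _ => (hfrac e he).2, fun _ => (hfrac e he).1⟩
      · simp [ext0, he]
    have hmax : ∀ c : ℝ, (∀ e, 0 ≤ f e + c * ext0 g e ∧ f e + c * ext0 g e ≤ G.w e) →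
        G.IsMaxFlow fun e => f e + c * ext0 g e := by
      intro c hc
      rw [isMaxFlow_iff]
      refine ⟨⟨hc, fun v hs ht => ?_⟩, ?_⟩
      · rw [netOut_add_mul, hg0, hflow.2 v hs ht]
        simp
      · rw [netOut_add_mul, hg0, hval]
        simp
    obtain ⟨ε, hε, h1⟩ := hbound 1
    obtain ⟨δ, hδ, h2⟩ := hbound (-1)
    have hp := hmax ε fun e => by simpa using h1 e
    have hn := hmax (-δ) fun e => by simpa using h2 e
    -- `f` lies strictly between the two maximum flows `f + ε g` and `f - δ g`
    have := hf.2 hp hn ⟨δ / (ε + δ), ε / (ε + δ), by positivity, by positivity, by field_simp; ring,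
      by ext e; simp; field_simp; ring⟩
    ext ⟨e, he⟩
    have h3 := congrFun this e
    have h4 : ext0 g e = g ⟨e, he⟩ := by simp [ext0, he]
    rw [← h4]
    have : ε * ext0 g e = 0 := by linarith
    simpa [hε.ne'] using this
  have := LinearMap.finrank_le_finrank_of_injective hinj
  rw [Module.finrank_fintype_fun_eq_card, Module.finrank_fintype_fun_eq_card] at this
  rw [← Nat.card_coe_set_eq, Nat.card_eq_fintype_card]
  exact this

end STNetwork
/-! ### Families of cuts that a DAG characterizes by 1-transversality -/

namespace QuotientDAG

variable {V : Type*}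

/-- On the directed paths of a cut whose complement no DAG edge leaves, the cut is an initial
segment; so the cut is 1-transversal. -/
theorem isTransversal_one_of_closed {D : QuotientDAG V} {X : Set (Fin D.numNodes)} {C : Set V}
    (hX : D.Represents X C) (h : ∀ a b, (a, b) ∈ D.edges → b ∈ X → a ∈ X) :
    D.IsTransversal 1 C := by
  refine ⟨X, hX, fun k p hp => ?_⟩
  have hanti : Antitone fun i => p i ∈ X :=
    Fin.antitone_iff_succ_le.2 fun i => h _ _ (hp.2 i)
  have key : ∀ i j : Fin k, p i.succ ∉ X → p j.castSucc ∈ X → ¬ i < j := fun i j hi hj hij =>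
    hi (hanti (show i.succ ≤ j.castSucc from hij) hj)
  rw [Set.ncard_le_one (Set.toFinite _)]
  intro i hi j hj
  have cross : ∀ i : Fin k, ¬ (p i.castSucc ∈ X ↔ p i.succ ∈ X) →
      p i.castSucc ∈ X ∧ p i.succ ∉ X := fun i hi => by
    have := h _ _ (hp.2 i)
    tauto
  obtain ⟨hi1, hi2⟩ := cross i hi
  obtain ⟨hj1, hj2⟩ := cross j hj
  exact le_antisymm (not_lt.1 (key j i hj2 hi1)) (not_lt.1 (key i j hi2 hj1))

/-- A DAG edge that enters a cut completes to a path `s, a, b, t` that crosses the cut three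
times, if the DAG has edges from `s` to all other nodes, and to `t` from all other nodes. -/
theorem IsTransversal.closed {D : QuotientDAG V} {C : Set V} (hC : D.IsTransversal 1 C) {s t : V}
    (hs : ∀ a, a ≠ D.proj s → (D.proj s, a) ∈ D.edges)
    (ht : ∀ a, a ≠ D.proj t → (a, D.proj t) ∈ D.edges) (hsC : s ∈ C) (htC : t ∉ C) {x y : V}
    (hxy : D.proj x ≠ D.proj y → (D.proj x, D.proj y) ∈ D.edges) (hy : y ∈ C) : x ∈ C := by
  obtain ⟨X, rfl, h⟩ := hC
  by_contra hx
  simp only [Set.mem_preimage] at *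
  generalize D.proj s = s at *
  generalize D.proj t = t at *
  generalize D.proj x = x at *
  generalize D.proj y = y at *
  have hsx : (s, x) ∈ D.edges := hs x fun h => hx (h ▸ hsC)
  have hyt : (y, t) ∈ D.edges := ht y fun h => htC (h ▸ hy)
  have hxy : (x, y) ∈ D.edges := hxy fun h => hx (h ▸ hy)
  have n1 : s ≠ x := fun h => hx (h ▸ hsC)
  have n2 : s ≠ y := fun h => D.acyclic s (.tail (.single hsx) (h ▸ hxy))
  have n3 : s ≠ t := fun h => htC (h ▸ hsC)
  have n4 : x ≠ y := fun h => hx (h ▸ hy)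
  have n5 : x ≠ t := fun h => D.acyclic x (.tail (.single hxy) (h ▸ hyt))
  have n6 : y ≠ t := fun h => htC (h ▸ hy)
  have := h 3 ![s, x, y, t] ⟨by
      intro i j hij
      fin_cases i <;> fin_cases j <;> simp_all, by
      intro i
      fin_cases i <;> assumption⟩
  rw [Set.ncard_le_one (Set.toFinite _)] at this
  have := this 0 (by simp [hsC, hx]) 1 (by simp [hy, hx])
  simp at this

variable [Fintype V]

/-- The cuts that separate `s` from `t` and respect each implication `y ∈ C → x ∈ C`,
`(x, y) ∈ R`, are the 1-transversal cuts of a DAG. Its edges are those of `R`, and the edges from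
`s` to all vertices and from all vertices to `t`; its nodes are the strongly connected components
of these. -/
theorem exists_isTransversal_iff (R : Finset (V × V)) (s t : V) :
    ∃ D : QuotientDAG V, D.space ≤ R.card + 4 * Fintype.card V ∧
      ∀ C : Set V, s ∈ C → t ∉ C →
        (D.IsTransversal 1 C ↔ ∀ x y, (x, y) ∈ R → y ∈ C → x ∈ C) := by
  classical
  let R' : Finset (V × V) := R ∪ (Finset.univ.image (fun x => (s, x)) ∪
    Finset.univ.image (fun x => (x, t)))
  have hR : ∀ x y, (x, y) ∈ R → (x, y) ∈ R' := fun x y h => by simp [R', h]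
  have hsR : ∀ x, (s, x) ∈ R' := fun x => by simp [R']
  have htR : ∀ x, (x, t) ∈ R' := fun x => by simp [R']
  let Q : V → V → Prop := fun x y => (x, y) ∈ R'
  let S : Setoid V :=
    { r := fun x y => Relation.ReflTransGen Q x y ∧ Relation.ReflTransGen Q y x
      iseqv := ⟨fun x => ⟨.refl, .refl⟩, fun h => ⟨h.2, h.1⟩,
        fun h h' => ⟨h.1.trans h'.1, h'.2.trans h.2⟩⟩ }
  let φ := Fintype.equivFin (Quotient S)
  let proj : V → Fin (Fintype.card (Quotient S)) := fun x => φ (Quotient.mk S x)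
  have hproj : ∀ x y, proj x = proj y ↔
      Relation.ReflTransGen Q x y ∧ Relation.ReflTransGen Q y x := fun x y => by
    simp only [proj, EmbeddingLike.apply_eq_iff_eq]
    exact Quotient.eq
  have hsurj : Function.Surjective proj := φ.surjective.comp Quotient.mk_surjective
  let edges := (R'.image fun q => (proj q.1, proj q.2)).filter fun q => q.1 ≠ q.2
  have hedge : ∀ a b, (a, b) ∈ edges ↔ ∃ x y, Q x y ∧ proj x = a ∧ proj y = b ∧ a ≠ b := by
    intro a b
    simp only [edges, Finset.mem_filter, Finset.mem_image, Prod.mk.injEq, Prod.exists, Q]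
    constructor
    · rintro ⟨⟨x, y, h, h1, h2⟩, h3⟩
      exact ⟨x, y, h, h1, h2, h3⟩
    · rintro ⟨x, y, h, h1, h2, h3⟩
      exact ⟨⟨x, y, h, h1, h2⟩, h3⟩
  have hreach : ∀ a b, Relation.ReflTransGen (fun a b => (a, b) ∈ edges) a b →
      ∀ x y, proj x = a → proj y = b → Relation.ReflTransGen Q x y := by
    intro a b h
    induction h with
    | refl => exact fun x y hx hy => ((hproj x y).1 (hx.trans hy.symm)).1
    | tail _ hbc ih =>
      intro x z hx hz
      obtain ⟨y, z', hyz, hy, hz', -⟩ := (hedge _ _).1 hbc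
      exact ((ih x y hx hy).tail hyz).trans ((hproj z' z).1 (hz'.trans hz.symm)).1
  let D : QuotientDAG V :=
    { numNodes := Fintype.card (Quotient S)
      proj := proj
      proj_surjective := hsurj
      edges := edges
      acyclic := by
        intro a h
        obtain ⟨b, hab, hba⟩ := Relation.TransGen.head'_iff.1 h
        obtain ⟨x, y, hxy, rfl, rfl, hne⟩ := (hedge _ _).1 hab
        exact hne ((hproj x y).2 ⟨.single hxy, hreach _ _ hba y x rfl rfl⟩) }
  refine ⟨D, ?_, fun C hs ht => ⟨fun h x y hxy hy => ?_, fun h => ?_⟩⟩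
  · have h1 : edges.card ≤ R.card + (Fintype.card V + Fintype.card V) :=
      calc edges.card ≤ R'.card := (Finset.card_filter_le _ _).trans Finset.card_image_le
        _ ≤ _ := (Finset.card_union_le _ _).trans (Nat.add_le_add_left
          ((Finset.card_union_le _ _).trans
            (Nat.add_le_add Finset.card_image_le Finset.card_image_le)) _)
    have h2 : D.numNodes ≤ Fintype.card V := by
      simpa using Fintype.card_le_of_surjective _ D.proj_surjective
    have h3 : D.edges.card = edges.card := rfl
    rw [space]
    omega
  · refine h.closed (fun a ha => ?_) (fun a ha => ?_) hs ht (fun hne => ?_) hy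
    · obtain ⟨x, rfl⟩ := hsurj a
      exact (hedge _ _).2 ⟨s, x, hsR x, rfl, rfl, ha.symm⟩
    · obtain ⟨x, rfl⟩ := hsurj a
      exact (hedge _ _).2 ⟨x, t, htR x, rfl, rfl, ha⟩
    · exact (hedge _ _).2 ⟨x, y, hR x y hxy, rfl, rfl, hne⟩
  · have hQ : ∀ x y, Q x y → y ∈ C → x ∈ C := by
      intro x y hxy hy
      simp only [Q, R', Finset.mem_union, Finset.mem_image, Finset.mem_univ, true_and,
        Prod.mk.injEq] at hxy
      rcases hxy with hxy | ⟨_, rfl, rfl⟩ | ⟨_, rfl, rfl⟩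
      · exact h x y hxy hy
      · exact hs
      · exact absurd hy ht
    have hQ' : ∀ x y, Relation.ReflTransGen Q x y → y ∈ C → x ∈ C := by
      intro x y hxy
      induction hxy with
      | refl => exact id
      | tail _ hyz ih => exact fun hz => ih (hQ _ _ hyz hz)
    refine isTransversal_one_of_closed (D := D) (X := proj '' C) ?_ ?_
    · ext x
      constructor
      · rintro ⟨y, hy, hxy⟩
        exact hQ' x y ((hproj y x).1 hxy).2 hy
      · exact fun hx => ⟨x, hx, rfl⟩
    · rintro a b hab ⟨z, hz, hzb⟩
      obtain ⟨x, y, hxy, rfl, rfl, -⟩ := (hedge _ _).1 hab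
      exact ⟨x, hQ x y hxy (hQ' y z ((hproj z y).1 hzb).2 hz), rfl⟩

end QuotientDAG

namespace STNetwork

variable {V E : Type*} [Fintype E]

/-- `C` has the least capacity among the `(s,t)`-cuts with `a` on the side of `s` and `b` on the
side of `t`. -/
def IsMinSeparator (G : STNetwork V E) (a b : V) (C : Set V) : Prop :=
  (G.IsCut C ∧ a ∈ C ∧ b ∉ C) ∧
    ∀ C', G.IsCut C' → a ∈ C' → b ∉ C' → G.capacity C ≤ G.capacity C'

theorem isMincutFor_iff_isMinSeparator (G : STNetwork V E) (e : E) (C : Set V) :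
    G.IsMincutFor e C ↔ G.IsMinSeparator (G.src e) (G.tgt e) C := by
  simp [IsMincutFor, IsMinSeparator, Contributes, and_assoc]

variable [Fintype V]

/-- Picard and Queyranne: the minimum cuts that separate `s, a` from `t, b` are the sets of
vertices that no edge leaves in the residual graph of a flow of maximum value; the two remaining
implications put `a` and `b` on their sides. -/
theorem exists_implications (G : STNetwork V E) (a b : V) :
    ∃ R : Finset (V × V), R.card ≤ 2 * Fintype.card E + 2 ∧
      ∀ C, G.IsCut C → (G.IsMinSeparator a b C ↔ ∀ x y, (x, y) ∈ R → y ∈ C → x ∈ C) := by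
  classical
  by_cases hdisj : Disjoint ({G.s, a} : Set V) {G.t, b}
  · obtain ⟨f, C₀, hf, hA, hB, hcap⟩ := G.exists_flow_cut hdisj
    have hC₀ : G.IsCut C₀ := ⟨hA (by simp), hB _ (by simp)⟩
    refine ⟨((Finset.univ.filter fun e => f e < G.w e).image fun e => (G.tgt e, G.src e)) ∪
      ((Finset.univ.filter fun e => 0 < f e).image fun e => (G.src e, G.tgt e)) ∪
      {(a, G.s), (G.t, b)}, ?_, fun C hC => ?_⟩
    · refine (Finset.card_union_le _ _).trans (Nat.add_le_add ?_ Finset.card_le_two)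
      rw [two_mul]
      refine (Finset.card_union_le _ _).trans (Nat.add_le_add ?_ ?_) <;>
        exact Finset.card_image_le.trans (Finset.card_le_univ _)
    · have hR : (∀ x y, (x, y) ∈ ((Finset.univ.filter fun e => f e < G.w e).image
          fun e => (G.tgt e, G.src e)) ∪ ((Finset.univ.filter fun e => 0 < f e).image
          fun e => (G.src e, G.tgt e)) ∪ {(a, G.s), (G.t, b)} → y ∈ C → x ∈ C) ↔
          (∀ x y, G.Residual f x y → x ∈ C → y ∈ C) ∧ a ∈ C ∧ b ∉ C := by
        constructor
        · intro h
          refine ⟨?_, h a G.s (by simp) hC.1, fun hb => hC.2 (h G.t b (by simp) hb)⟩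
          rintro x y ⟨e, ⟨rfl, rfl, he⟩ | ⟨rfl, rfl, he⟩⟩ hx
          · refine h _ _ (Finset.mem_union_left _ (Finset.mem_union_left _ ?_)) hx
            exact Finset.mem_image.2 ⟨e, by simpa using he, rfl⟩
          · refine h _ _ (Finset.mem_union_left _ (Finset.mem_union_right _ ?_)) hx
            exact Finset.mem_image.2 ⟨e, by simpa using he, rfl⟩
        · rintro ⟨h, ha, hb⟩ x y hxy hy
          simp only [Finset.mem_union, Finset.mem_image, Finset.mem_filter, Finset.mem_univ,
            true_and, Prod.mk.injEq, Finset.mem_insert, Finset.mem_singleton] at hxy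
          rcases hxy with (⟨e, he, rfl, rfl⟩ | ⟨e, he, rfl, rfl⟩) | ⟨rfl, rfl⟩ | ⟨rfl, rfl⟩
          · exact h _ _ ⟨e, .inl ⟨rfl, rfl, he⟩⟩ hy
          · exact h _ _ ⟨e, .inr ⟨rfl, rfl, he⟩⟩ hy
          · exact ha
          · exact absurd hy hb
      rw [hR, ← sum_slack_eq_zero_iff hf.1]
      have key : ∀ C, G.IsCut C → a ∈ C → b ∉ C →
          G.capacity C = G.netOutSet {G.s, a} f + ∑ e, G.slack C f e := fun C hC ha hb =>
        capacity_eq_add_slack hf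
          (by rintro x (rfl | rfl); exacts [hC.1, ha]) (by rintro x (rfl | rfl); exacts [hC.2, hb])
      constructor
      · rintro ⟨⟨_, ha, hb⟩, hmin⟩
        have h1 := hmin C₀ hC₀ (hA (by simp)) (hB _ (by simp))
        have h2 := key C hC ha hb
        have h3 := Finset.sum_nonneg fun e (_ : e ∈ Finset.univ) => slack_nonneg hf.1 C e
        exact ⟨by linarith, ha, hb⟩
      · rintro ⟨h0, ha, hb⟩
        refine ⟨⟨hC, ha, hb⟩, fun C' hC' ha' hb' => ?_⟩
        rw [key C hC ha hb, key C' hC' ha' hb', h0]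
        have h3 := Finset.sum_nonneg fun e (_ : e ∈ Finset.univ) => slack_nonneg hf.1 C' e
        linarith
  · -- no cut separates the terminals
    refine ⟨{(G.t, G.s)}, by simp, fun C hC => ⟨fun h => ?_, fun h => ?_⟩⟩
    · refine (hdisj (Set.disjoint_left.2 ?_)).elim
      rintro x (rfl | rfl) (h' | h')
      · exact G.s_ne_t h'
      · exact h.1.2.2 (Set.mem_singleton_iff.1 h' ▸ hC.1)
      · exact hC.2 (h' ▸ h.1.2.1)
      · exact h.1.2.2 (Set.mem_singleton_iff.1 h' ▸ h.1.2.1)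
    · exact absurd (h G.t G.s (by simp) hC.1) hC.2

theorem exists_dag_isMinSeparator (G : STNetwork V E) (a b : V) :
    ∃ D : QuotientDAG V, D.space ≤ 2 * Fintype.card E + 2 + 4 * Fintype.card V ∧
      ∀ C, G.IsCut C → (D.IsTransversal 1 C ↔ G.IsMinSeparator a b C) := by
  obtain ⟨R, hR, h⟩ := G.exists_implications a b
  obtain ⟨D, hD, hDR⟩ := QuotientDAG.exists_isTransversal_iff R G.s G.t
  exact ⟨D, by omega, fun C hC => (hDR C hC.1 hC.2).trans (h C hC).symm⟩

end STNetwork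
/-! ### Steiner mincuts and the hierarchy tree -/

namespace STNetwork

variable {V E : Type*} [Fintype E] {G : STNetwork V E}

/-- For `x ∈ S`, the class of `x` under the relation of not being separated by a Steiner mincut
for `S`: the child of `S` in the hierarchy tree that contains `x`. -/
def cell (G : STNetwork V E) (S : Set V) (x : V) : Set V := {y | y ∈ S ∧ G.NotSeparated S x y}

theorem cell_subset (G : STNetwork V E) (S : Set V) (x : V) : G.cell S x ⊆ S := fun _ h => h.1

theorem mem_cell_self {S : Set V} {x : V} (hx : x ∈ S) : x ∈ G.cell S x :=
  ⟨hx, fun _ _ => Iff.rfl⟩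

theorem cell_eq_of_mem {S : Set V} {x y : V} (h : y ∈ G.cell S x) : G.cell S y = G.cell S x :=
  Set.ext fun _ => and_congr_right fun _ =>
    forall₂_congr fun C hC => by rw [h.2 C hC]

/-- Two tree nodes with a common vertex are nested, and the smaller one lies inside a single child
of the larger one unless they coincide. -/
theorem IsTreeNode.subset_cell_or_subset {S T : Set V} (hS : G.IsTreeNode S) (hT : G.IsTreeNode T)
    {x : V} (hxS : x ∈ S) (hxT : x ∈ T) : T ⊆ G.cell S x ∨ S ⊆ T := by
  suffices h : ∀ S, G.IsTreeNode S → x ∈ S →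
      (T ⊆ G.cell S x ∨ S ⊆ T) ∧ (S ⊆ G.cell T x ∨ T ⊆ S) from (h S hS hxS).1
  -- if `T` is a child of `T₀`, then `S ⊆ T₀` leaves only `S ⊆ cell T₀ x = T` and `S = T₀`
  have step : ∀ S T₀ y, x ∈ G.cell T₀ y → (T₀ ⊆ G.cell S x ∨ S ⊆ T₀) →
      (S ⊆ G.cell T₀ x ∨ T₀ ⊆ S) → (G.cell T₀ y ⊆ G.cell S x ∨ S ⊆ G.cell T₀ y) := by
    intro S T₀ y hx h1 h2
    rw [← cell_eq_of_mem hx]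
    rcases h1 with h1 | h1
    · exact .inl ((G.cell_subset _ _).trans h1)
    · rcases h2 with h2 | h2
      · exact .inr h2
      · rw [h1.antisymm h2]
        exact .inl subset_rfl
  induction hT with
  | root =>
    intro S hS hxS
    refine ⟨.inr (Set.subset_univ _), ?_⟩
    induction hS with
    | root => exact .inr subset_rfl
    | child S₀ y _ _ _ ih =>
      exact step Set.univ S₀ y hxS (ih hxS.1) (.inr (Set.subset_univ _))
  | child T₀ z _ _ _ ih =>
    intro S hS hxS
    have h1 : ∀ S, G.IsTreeNode S → x ∈ S → (G.cell T₀ z ⊆ G.cell S x ∨ S ⊆ G.cell T₀ z) :=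
      fun S hS hxS => step S T₀ z hxT (ih hxT.1 S hS hxS).1 (ih hxT.1 S hS hxS).2
    refine ⟨h1 S hS hxS, ?_⟩
    induction hS with
    | root => exact .inr (Set.subset_univ _)
    | child S₀ y hS₀ _ _ ih' =>
      exact step (G.cell T₀ z) S₀ y hxS (ih' hxS.1) (h1 S₀ hS₀ hxS.1)

theorem IsTreeNode.nonempty {S : Set V} (hS : G.IsTreeNode S) : S.Nonempty := by
  cases hS with
  | root => exact ⟨G.s, trivial⟩
  | child S x _ _ hx => exact ⟨x, mem_cell_self hx⟩

/-- The pivots of tree nodes are their least elements for a numbering `r` of the vertices. A child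
that does not contain the pivot of its parent is then determined by its own pivot. -/
theorem IsTreeNode.eq_of_pivot {S T : Set V} (hS : G.IsTreeNode S) (hT : G.IsTreeNode T)
    {r : V → ℕ} (hr : Function.Injective r) {pivot : Set V → V}
    (hp : ∀ S : Set V, S.Nonempty → pivot S ∈ S ∧ ∀ y ∈ S, r (pivot S) ≤ r y) {x : V}
    (hxS : x ∈ S) (hxT : x ∈ T) (hS1 : pivot (G.cell S x) = x) (hS2 : pivot S ≠ x)
    (hT1 : pivot (G.cell T x) = x) (hT2 : pivot T ≠ x) : S = T := by
  have key : ∀ S T : Set V, x ∈ S → x ∈ T → pivot (G.cell S x) = x → pivot T ≠ x →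
      ¬ T ⊆ G.cell S x := by
    intro S T hxS hxT h1 h2 hsub
    have hTp := hp T ⟨x, hxT⟩
    have := (hp (G.cell S x) ⟨x, mem_cell_self hxS⟩).2 _ (hsub hTp.1)
    rw [h1] at this
    exact h2 (hr (le_antisymm (hTp.2 x hxT) this))
  exact ((hS.subset_cell_or_subset hT hxS hxT).resolve_left (key S T hxS hxT hS1 hT2)).antisymm
    ((hT.subset_cell_or_subset hS hxT hxS).resolve_left (key T S hxT hxS hT1 hS2))

theorem IsSteinerMincut.isMinSeparator_iff {S : Set V} {a b : V} (ha : a ∈ S) (hb : b ∈ S)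
    {C₀ : Set V} (h₀ : G.IsSteinerMincut S C₀) (ha₀ : a ∈ C₀) (hb₀ : b ∉ C₀) (C : Set V) :
    G.IsMinSeparator a b C ↔ G.IsSteinerMincut S C ∧ a ∈ C ∧ b ∉ C := by
  constructor
  · rintro ⟨⟨hC, haC, hbC⟩, hmin⟩
    exact ⟨⟨⟨hC, ⟨a, ha, haC⟩, ⟨b, hb, hbC⟩⟩, fun C' hC' =>
      (hmin C₀ h₀.1.1 ha₀ hb₀).trans (h₀.2 C' hC')⟩, haC, hbC⟩
  · rintro ⟨hC, haC, hbC⟩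
    exact ⟨⟨hC.1.1, haC, hbC⟩, fun C' hC' ha' hb' =>
      hC.2 C' ⟨hC', ⟨a, ha, ha'⟩, ⟨b, hb, hb'⟩⟩⟩

/-- At a node whose children separate the endpoints of a tight edge, the mincuts for the edge are
the Steiner mincuts to which it contributes: a Steiner mincut that separates the endpoints cannot
have the edge as an incoming one, since its capacity would be too large. -/
theorem IsTight.isMincutFor_iff [Fintype V] {e : E} (he : G.IsTight e) {S : Set V}
    (hS : G.IsLCA S (G.src e) (G.tgt e)) (C : Set V) :
    G.IsMincutFor e C ↔ G.IsSteinerMincut S C ∧ G.Contributes C e := by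
  obtain ⟨-, hs, ht, hsep⟩ := hS
  simp only [NotSeparated, not_forall] at hsep
  obtain ⟨D, hD, hsep⟩ := hsep
  have hDe : G.src e ∈ D ∧ G.tgt e ∉ D := by
    by_contra hcon
    obtain ⟨C', hC', hc, hlt⟩ := he.capacity_lt hD.1.1 (by tauto) (by tauto)
    exact not_lt.2 (hD.2 C' ⟨hC', ⟨_, hs, hc.1⟩, ⟨_, ht, hc.2⟩⟩) hlt
  rw [isMincutFor_iff_isMinSeparator, hD.isMinSeparator_iff hs ht hDe.1 hDe.2]
  rfl

variable [Fintype V]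

theorem exists_isSteinerMincut (G : STNetwork V E) {S : Set V} (hS : S.Nontrivial) :
    ∃ C, G.IsSteinerMincut S C := by
  suffices h : ∃ C, G.IsSteinerCut S C from
    Set.exists_min_image {C | G.IsSteinerCut S C} G.capacity (Set.toFinite _) h
  obtain ⟨x, hx, y, hy, hxy⟩ := hS
  -- one of the two vertices joins `s`, and the other one `t`
  have main : ∀ x ∈ S, ∀ y ∈ S, x ≠ y → x ≠ G.t → y ≠ G.s → ∃ C, G.IsSteinerCut S C := by
    intro x hx y hy hxy hxt hys
    refine ⟨{G.s, x}, ⟨by simp, ?_⟩, ⟨x, hx, by simp⟩, ⟨y, hy, ?_⟩⟩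
    · simp [G.s_ne_t.symm, Ne.symm hxt]
    · simp [hys, hxy.symm]
  by_cases h : x ≠ G.t ∧ y ≠ G.s
  · exact main x hx y hy hxy h.1 h.2
  · have := G.s_ne_t
    refine main y hy x hx hxy.symm ?_ ?_
    · rintro rfl
      exact h ⟨hxy, this.symm⟩
    · rintro rfl
      exact h ⟨this, hxy.symm⟩

/-- A child in the hierarchy tree is strictly smaller than its parent. -/
theorem cell_ssubset {S : Set V} (hS : S.Nontrivial) (x : V) : G.cell S x ⊂ S := by
  obtain ⟨C, hC⟩ := G.exists_isSteinerMincut hS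
  obtain ⟨⟨-, ⟨y, hyS, hyC⟩, ⟨z, hzS, hzC⟩⟩, -⟩ := id hC
  refine ⟨G.cell_subset S x, fun h => hzC ?_⟩
  exact ((h hzS).2 C hC).1 (((h hyS).2 C hC).2 hyC)

theorem exists_isLCA (G : STNetwork V E) {u v : V} (huv : u ≠ v) : ∃ S, G.IsLCA S u v := by
  obtain ⟨S, ⟨hS, hu, hv⟩, hmin⟩ := Set.exists_min_image
    {S | G.IsTreeNode S ∧ u ∈ S ∧ v ∈ S} Set.ncard (Set.toFinite _)
    ⟨Set.univ, .root, trivial, trivial⟩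
  have hnt : S.Nontrivial := ⟨u, hu, v, hv, huv⟩
  refine ⟨S, hS, hu, hv, fun hsep => ?_⟩
  exact not_lt.2 (hmin (G.cell S u) ⟨.child S u hS hnt hu, mem_cell_self hu, hv, hsep⟩)
    (Set.ncard_lt_ncard (cell_ssubset hnt u))

theorem exists_dag_isSteinerMincut (G : STNetwork V E) {S : Set V} {a b : V} (ha : a ∈ S)
    (hb : b ∈ S) :
    ∃ D : QuotientDAG V, D.space ≤ 2 * Fintype.card E + 2 + 4 * Fintype.card V ∧
      ∀ C, G.IsCut C → (D.IsTransversal 1 C ↔ G.IsSteinerMincut S C ∧ a ∈ C ∧ b ∉ C) := by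
  by_cases h : ∃ C₀, G.IsSteinerMincut S C₀ ∧ a ∈ C₀ ∧ b ∉ C₀
  · obtain ⟨C₀, h₀, ha₀, hb₀⟩ := h
    obtain ⟨D, hD, hDC⟩ := G.exists_dag_isMinSeparator a b
    exact ⟨D, hD, fun C hC => (hDC C hC).trans (h₀.isMinSeparator_iff ha hb ha₀ hb₀ C)⟩
  · -- no vertex is separated from itself, so that this DAG has no 1-transversal `(s,t)`-cut
    obtain ⟨D, hD, hDC⟩ := G.exists_dag_isMinSeparator a a
    refine ⟨D, hD, fun C hC => (hDC C hC).trans ⟨fun h' => ?_, fun h' => (h ⟨C, h'⟩).elim⟩⟩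
    exact absurd h'.1.2.1 h'.1.2.2

/-! ### The structure -/

/-- The properties that the theorem asks of the two DAGs of a vital edge. -/
def IsDAGPairFor (G : STNetwork V E) (pivot : Set V → V) (e : E) (D₁ D₂ : QuotientDAG V) : Prop :=
  (∀ C, G.IsMincutFor e C → D₁.Stores C ∨ D₂.Stores C) ∧
  (∀ C, G.IsCut C → (G.IsMincutFor e C ↔
    (D₁.IsTransversal 1 C ∨ D₂.IsTransversal 1 C) ∧ G.Contributes C e)) ∧
  (G.IsLoose e → D₁ = D₂ ∧ ∀ C, G.IsCut C → (D₁.IsTransversal 1 C ↔ G.IsMincutFor e C)) ∧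
  (G.IsTight e → ∃ S, G.IsLCA S (G.src e) (G.tgt e) ∧ ∀ C, G.IsCut C →
    (D₁.IsTransversal 1 C ↔ G.IsSteinerMincut S C ∧ pivot S ∈ C ∧ G.tgt e ∉ C) ∧
    (D₂.IsTransversal 1 C ↔ G.IsSteinerMincut S C ∧ G.src e ∈ C ∧ pivot S ∉ C))

omit [Fintype V] in
theorem isDAGPairFor_of_isLoose {pivot : Set V → V} {e : E} (he : G.IsLoose e) {D : QuotientDAG V}
    (hD : ∀ C, G.IsCut C → (D.IsTransversal 1 C ↔ G.IsMinSeparator (G.src e) (G.tgt e) C)) :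
    G.IsDAGPairFor pivot e D D := by
  simp only [← isMincutFor_iff_isMinSeparator] at hD
  refine ⟨fun C hC => .inl ?_, fun C hC => ?_, fun _ => ⟨rfl, hD⟩, fun h => (he.2 h.2).elim⟩
  · obtain ⟨X, hX, -⟩ := (hD C hC.1).2 hC
    exact ⟨X, hX⟩
  · rw [or_self, hD C hC]
    exact ⟨fun h => ⟨h, h.2.1⟩, fun h => h.1⟩

theorem isDAGPairFor_of_isTight {pivot : Set V → V} {e : E} (he : G.IsTight e) {S : Set V}
    (hS : G.IsLCA S (G.src e) (G.tgt e)) {D₁ D₂ : QuotientDAG V}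
    (h₁ : ∀ C, G.IsCut C →
      (D₁.IsTransversal 1 C ↔ G.IsSteinerMincut S C ∧ pivot S ∈ C ∧ G.tgt e ∉ C))
    (h₂ : ∀ C, G.IsCut C →
      (D₂.IsTransversal 1 C ↔ G.IsSteinerMincut S C ∧ G.src e ∈ C ∧ pivot S ∉ C)) :
    G.IsDAGPairFor pivot e D₁ D₂ := by
  have key : ∀ C, G.IsCut C → (G.IsMincutFor e C ↔
      (D₁.IsTransversal 1 C ∨ D₂.IsTransversal 1 C) ∧ G.Contributes C e) := by
    intro C hC
    rw [he.isMincutFor_iff hS, h₁ C hC, h₂ C hC]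
    unfold Contributes
    tauto
  refine ⟨fun C hC => ?_, key, fun h => (h.2 he.2).elim, fun _ => ⟨S, hS, fun C hC =>
    ⟨h₁ C hC, h₂ C hC⟩⟩⟩
  exact ((key C hC.1).1 hC).1.imp (fun ⟨X, hX, _⟩ => ⟨X, hX⟩) fun ⟨X, hX, _⟩ => ⟨X, hX⟩

/-- The DAGs for all vital edges, before they are numbered. For a tight edge, the DAG depends only
on the lowest common ancestor and on the child of it that contains one of the endpoints; unless
this child contains the pivot, in which case no cut qualifies, both are determined by the pivot of
the child. So `2n + 1` DAGs serve all the tight edges, and `n` further ones the loose edges. -/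
theorem exists_dags (G : STNetwork V E) :
    ∃ (pivot : Set V → V) (𝒟 : Set (QuotientDAG V)),
      𝒟.Finite ∧ 𝒟.ncard ≤ 3 * Fintype.card V + 1 ∧
      (∀ D ∈ 𝒟, D.space ≤ 2 * Fintype.card E + 2 + 4 * Fintype.card V) ∧
      (∀ S, G.IsTreeNode S → pivot S ∈ S) ∧
      ∀ e, ∃ D₁ ∈ 𝒟, ∃ D₂ ∈ 𝒟, G.IsVital e → G.IsDAGPairFor pivot e D₁ D₂ := by
  classical
  obtain ⟨r, hr⟩ : ∃ r : V → ℕ, Function.Injective r :=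
    ⟨fun v => Fintype.equivFin V v, Fin.val_injective.comp (Fintype.equivFin V).injective⟩
  have hpiv : ∀ S : Set V, ∃ p, S.Nonempty → p ∈ S ∧ ∀ y ∈ S, r p ≤ r y := fun S => by
    by_cases h : S.Nonempty
    · obtain ⟨p, hp⟩ := Set.exists_min_image S r (Set.toFinite _) h
      exact ⟨p, fun _ => hp⟩
    · exact ⟨G.s, fun h' => (h h').elim⟩
  choose pivot hp using hpiv
  -- `S` has a child with pivot `x` that does not contain the pivot of `S`
  let P : Set V → V → Prop := fun S x =>
    G.IsTreeNode S ∧ x ∈ S ∧ pivot (G.cell S x) = x ∧ pivot S ≠ x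
  have hPuniq : ∀ S T x, P S x → P T x → S = T := fun S T x hS hT =>
    hS.1.eq_of_pivot hT.1 hr hp hS.2.1 hT.2.1 hS.2.2.1 hS.2.2.2 hT.2.2.1 hT.2.2.2
  obtain ⟨D₀, hD₀, hD₀C⟩ := G.exists_dag_isMinSeparator G.s G.s
  have hD₀C : ∀ C, G.IsCut C → ¬ D₀.IsTransversal 1 C := fun C hC h =>
    absurd ((hD₀C C hC).1 h).1.2.1 ((hD₀C C hC).1 h).1.2.2
  have hds : ∀ x, ∃ D : QuotientDAG V, D.space ≤ 2 * Fintype.card E + 2 + 4 * Fintype.card V ∧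
      ∀ S, P S x → ∀ C, G.IsCut C →
        (D.IsTransversal 1 C ↔ G.IsSteinerMincut S C ∧ pivot S ∈ C ∧ x ∉ C) := fun x => by
    by_cases h : ∃ S, P S x
    · obtain ⟨S, hS⟩ := h
      obtain ⟨D, hD, hDC⟩ := G.exists_dag_isSteinerMincut (hp S ⟨x, hS.2.1⟩).1 hS.2.1
      exact ⟨D, hD, fun T hT => hPuniq S T x hS hT ▸ hDC⟩
    · exact ⟨D₀, hD₀, fun S hS => (h ⟨S, hS⟩).elim⟩
  have hdt : ∀ x, ∃ D : QuotientDAG V, D.space ≤ 2 * Fintype.card E + 2 + 4 * Fintype.card V ∧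
      ∀ S, P S x → ∀ C, G.IsCut C →
        (D.IsTransversal 1 C ↔ G.IsSteinerMincut S C ∧ x ∈ C ∧ pivot S ∉ C) := fun x => by
    by_cases h : ∃ S, P S x
    · obtain ⟨S, hS⟩ := h
      obtain ⟨D, hD, hDC⟩ := G.exists_dag_isSteinerMincut hS.2.1 (hp S ⟨x, hS.2.1⟩).1
      exact ⟨D, hD, fun T hT => hPuniq S T x hS hT ▸ hDC⟩
    · exact ⟨D₀, hD₀, fun S hS => (h ⟨S, hS⟩).elim⟩
  choose ds hds hdsC using hds
  choose dt hdt hdtC using hdt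
  choose dl hdl hdlC using fun e => G.exists_dag_isMinSeparator (G.src e) (G.tgt e)
  let 𝒟 : Set (QuotientDAG V) := Set.range ds ∪ Set.range dt ∪ dl '' {e | G.IsLoose e} ∪ {D₀}
  have hrange : ∀ d : V → QuotientDAG V, (Set.range d).ncard ≤ Fintype.card V := fun d => by
    rw [← Set.image_univ]
    exact (Set.ncard_image_le (Set.toFinite _)).trans (by simp [Set.ncard_univ])
  refine ⟨pivot, 𝒟, Set.toFinite _, ?_, ?_, fun S hS => (hp S hS.nonempty).1, fun e => ?_⟩
  · have h1 := hrange ds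
    have h2 := hrange dt
    have h3 := (Set.ncard_image_le (f := dl) (Set.toFinite {e | G.IsLoose e})).trans
      G.card_isLoose_le
    have h4 := Set.ncard_union_le (Set.range ds ∪ Set.range dt ∪ dl '' {e | G.IsLoose e}) {D₀}
    have h5 := Set.ncard_union_le (Set.range ds ∪ Set.range dt) (dl '' {e | G.IsLoose e})
    have h6 := Set.ncard_union_le (Set.range ds) (Set.range dt)
    rw [Set.ncard_singleton] at h4
    show Set.ncard (Set.range ds ∪ Set.range dt ∪ dl '' {e | G.IsLoose e} ∪ {D₀}) ≤ _
    omega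
  · rintro D (((⟨x, rfl⟩ | ⟨x, rfl⟩) | ⟨e, -, rfl⟩) | rfl)
    exacts [hds x, hdt x, hdl e, hD₀]
  · have hD₀𝒟 : D₀ ∈ 𝒟 := .inr rfl
    by_cases hl : G.IsLoose e
    · have : dl e ∈ 𝒟 := .inl (.inr ⟨e, hl, rfl⟩)
      exact ⟨dl e, this, dl e, this, fun _ => isDAGPairFor_of_isLoose hl (hdlC e)⟩
    by_cases hv : G.IsVital e
    swap
    · exact ⟨D₀, hD₀𝒟, D₀, hD₀𝒟, fun h => (hv h).elim⟩
    have ht : G.IsTight e := ⟨hv, by_contra fun h => hl ⟨hv, h⟩⟩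
    obtain ⟨S, hS⟩ := G.exists_isLCA hv.src_ne_tgt
    -- in a class of `S`, each vertex may be replaced by the pivot of the class
    have hrep : ∀ v ∈ S, ∃ x, (pivot S = x ∨ P S x) ∧
        ∀ C, G.IsSteinerMincut S C → (v ∈ C ↔ x ∈ C) := by
      intro v hv
      have hx := (hp (G.cell S v) ⟨v, mem_cell_self hv⟩).1
      refine ⟨_, ?_, hx.2⟩
      by_cases h : pivot S = pivot (G.cell S v)
      · exact .inl h
      · exact .inr ⟨hS.1, hx.1, by rw [cell_eq_of_mem hx], h⟩
    obtain ⟨x, hx, hxC⟩ := hrep _ hS.2.2.1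
    obtain ⟨y, hy, hyC⟩ := hrep _ hS.2.1
    have hs : ∃ D ∈ 𝒟, ∀ C, G.IsCut C →
        (D.IsTransversal 1 C ↔ G.IsSteinerMincut S C ∧ pivot S ∈ C ∧ G.tgt e ∉ C) := by
      rcases hx with rfl | hx
      · refine ⟨D₀, hD₀𝒟, fun C hC => iff_of_false (hD₀C C hC) ?_⟩
        rintro ⟨h1, h2, h3⟩
        exact h3 ((hxC C h1).2 h2)
      · refine ⟨ds x, .inl (.inl (.inl ⟨x, rfl⟩)), fun C hC => (hdsC x S hx C hC).trans ?_⟩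
        exact and_congr_right fun h => and_congr_right fun _ => not_congr (hxC C h).symm
    have ht' : ∃ D ∈ 𝒟, ∀ C, G.IsCut C →
        (D.IsTransversal 1 C ↔ G.IsSteinerMincut S C ∧ G.src e ∈ C ∧ pivot S ∉ C) := by
      rcases hy with rfl | hy
      · refine ⟨D₀, hD₀𝒟, fun C hC => iff_of_false (hD₀C C hC) ?_⟩
        rintro ⟨h1, h2, h3⟩
        exact h3 ((hyC C h1).1 h2)
      · refine ⟨dt y, .inl (.inl (.inr ⟨y, rfl⟩)), fun C hC => (hdtC y S hy C hC).trans ?_⟩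
        exact and_congr_right fun h => and_congr_left fun _ => (hyC C h).symm
    obtain ⟨D₁, hD₁, h₁⟩ := hs
    obtain ⟨D₂, hD₂, h₂⟩ := ht'
    exact ⟨D₁, hD₁, D₂, hD₂, fun _ => isDAGPairFor_of_isTight ht hS h₁ h₂⟩

end STNetwork

theorem theorem1p7 :
    ∃ c : ℕ, ∀ (V E : Type*) [Fintype V] [Fintype E] (G : STNetwork V E),
      ∃ (F : DAGStructure V E) (pivot : Set V → V),
        -- `O(n)` DAGs, `O(mn)` space
        F.numDAGs ≤ c * Fintype.card V ∧
        F.space ≤ c * (Fintype.card E * Fintype.card V) ∧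
        (∀ S, G.IsTreeNode S → pivot S ∈ S) ∧
        ∀ e : E, G.IsVital e → ∃ i j : Fin F.numDAGs, F.table e = some (i, j) ∧
          -- the two DAGs store all mincuts for `e`
          (∀ C, G.IsMincutFor e C → (F.dag i).Stores C ∨ (F.dag j).Stores C) ∧
          -- they characterize the mincuts for `e` by 1-transversality
          (∀ C, G.IsCut C →
            (G.IsMincutFor e C ↔
              ((F.dag i).IsTransversal 1 C ∨ (F.dag j).IsTransversal 1 C) ∧
                G.Contributes C e)) ∧
          -- for a loose edge, both are one Picard-Queyranne DAG, for the mincuts for `e`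
          (G.IsLoose e → i = j ∧
            ∀ C, G.IsCut C → ((F.dag i).IsTransversal 1 C ↔ G.IsMincutFor e C)) ∧
          -- for a tight edge, they are the DAGs, at the lowest common ancestor of the endpoints in
          -- the hierarchy tree, for Steiner mincuts that separate an endpoint and the pivot
          (G.IsTight e → ∃ S, G.IsLCA S (G.src e) (G.tgt e) ∧
            ∀ C, G.IsCut C →
              ((F.dag i).IsTransversal 1 C ↔
                G.IsSteinerMincut S C ∧ pivot S ∈ C ∧ G.tgt e ∉ C) ∧
              ((F.dag j).IsTransversal 1 C ↔
                G.IsSteinerMincut S C ∧ G.src e ∈ C ∧ pivot S ∉ C)) := by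
  refine ⟨22, fun V E _ _ G => ?_⟩
  obtain ⟨pivot, 𝒟, hfin, hcard, hspace, hpivot, hD⟩ := G.exists_dags
  choose d₁ hd₁ d₂ hd₂ hpair using hD
  -- only the DAGs in use are kept, since `2 m` of them fit into the space bound even if `m < n`
  let 𝒰 : Set (QuotientDAG V) := Set.range d₁ ∪ Set.range d₂
  have h𝒰 : 𝒰 ⊆ 𝒟 := by
    rintro D (⟨e, rfl⟩ | ⟨e, rfl⟩)
    exacts [hd₁ e, hd₂ e]
  have hn : 𝒰.ncard ≤ 3 * Fintype.card V + 1 := (Set.ncard_le_ncard h𝒰 hfin).trans hcard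
  have hm : 𝒰.ncard ≤ 2 * Fintype.card E := by
    have hrange : ∀ d : E → QuotientDAG V, (Set.range d).ncard ≤ Fintype.card E := fun d => by
      rw [← Set.image_univ]
      exact (Set.ncard_image_le (Set.toFinite _)).trans (by simp [Set.ncard_univ])
    have h1 := hrange d₁
    have h2 := hrange d₂
    have h3 : 𝒰.ncard ≤ _ := Set.ncard_union_le (Set.range d₁) (Set.range d₂)
    omega
  have hV : 1 ≤ Fintype.card V := Fintype.card_pos_iff.2 ⟨G.s⟩
  let φ : 𝒰 ≃ Fin 𝒰.ncard := Finite.equivFinOfCardEq (Nat.card_coe_set_eq 𝒰)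
  let i₁ : E → Fin 𝒰.ncard := fun e => φ ⟨d₁ e, .inl ⟨e, rfl⟩⟩
  let i₂ : E → Fin 𝒰.ncard := fun e => φ ⟨d₂ e, .inr ⟨e, rfl⟩⟩
  refine ⟨⟨𝒰.ncard, fun i => (φ.symm i).1, fun e => some (i₁ e, i₂ e)⟩, pivot, ?_, ?_, hpivot,
    fun e he => ⟨i₁ e, i₂ e, rfl, ?_⟩⟩
  · show 𝒰.ncard ≤ _
    omega
  · have hsum := Finset.sum_le_card_nsmul Finset.univ
      (fun i : Fin 𝒰.ncard => (φ.symm i).1.space) _ fun i _ => hspace _ (h𝒰 (φ.symm i).2)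
    simp only [Finset.card_univ, Fintype.card_fin, smul_eq_mul] at hsum
    show ∑ i : Fin 𝒰.ncard, (φ.symm i).1.space + 2 * Fintype.card E ≤ _
    have h1 := Nat.mul_le_mul_right (2 * Fintype.card E) hn
    have h2 := Nat.mul_le_mul_right (2 + 4 * Fintype.card V) hm
    have h3 := Nat.mul_le_mul_left (Fintype.card E) hV
    nlinarith
  · obtain ⟨h1, h2, h3, h4⟩ := hpair e he
    have e₁ : (φ.symm (i₁ e)).1 = d₁ e := by simp [i₁]
    have e₂ : (φ.symm (i₂ e)).1 = d₂ e := by simp [i₂]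
    simp only [e₁, e₂]
    refine ⟨h1, h2, fun hl => ⟨?_, (h3 hl).2⟩, h4⟩
    simp only [i₁, i₂, (h3 hl).1]
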